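/- Let $\Omega$ be a set, $\Sigma$ a $\sigma$-algebra of subsets of $\Omega$, and $\lambda:\Sigma\to\mathbb R$ a (finite, signed) $\sigma$-additive measure with total variation $|\lambda|$. Let $ba(\Omega,\Sigma)$ be the vector lattice of all bounded finitely additive $\mu:\Sigma\to\mathbb R$, ordered setwise, with $|\mu|=\mu\vee(-\mu)$, and let $ca(\Omega,\Sigma)$ be the set of its $\sigma$-additive elements. Call $\mu\in ba(\Omega,\Sigma)$ \emph{pure} if $|\mu|\wedge|\nu|=0$ for every $\nu\in ca(\Omega,\Sigma)$, and \emph{weakly absolutely continuous} with respect to $\lambda$ if $\mu(A)=0$ for every $A\in\Sigma$ with $|\lambda|(A)=0$. A function $f:\Omega\to\mathbb R$ is \emph{$\mu$-integrable} with integral $\int_\Omega f\,d\mu=I$ if there are $\Sigma$-simple functions $s_k$ such that $|\mu|^*(\{|s_k-f|>\varepsilon\})\to0$ for every $\varepsilon>0$, where $|\mu|^*(B)=\inf\{|\mu|(A): A\in\Sigma,\ B\subset A\}$, $\int_\Omega|s_k-s_l|\,d|\mu|\to0$ as $k,l\to\infty$, and $\int_\Omega s_k\,d\mu\to I$. Then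 for every continuous linear functional $u$ on the real space $L^\infty(\Omega,\Sigma,\lambda)$ there exist a unique $g\in L^1(\Omega,\Sigma,\lambda)$ and a unique pure $\mu_p\in ba(\Omega,\Sigma)$ that is weakly absolutely continuous with respect to $\lambda$, such that every (representative of an) $f\in L^\infty(\Omega,\Sigma,\lambda)$ is $\mu_p$-integrable and $$\langle u,f\rangle=\int_\Omega f\,g\,d\lambda+\int_\Omega f\,d\mu_p .$$ -/

import Mathlib

open MeasureTheory Filter Topology
open scoped ENNReal

/-- A bounded finitely additive real set function (a bounded "measure") on the `σ`-algebra of a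
measurable space; these form the space `ba(Ω, Σ)`. As for `MeasureTheory.VectorMeasure`, the
value on a non-measurable set is `0` by convention, so that two elements are equal iff they agree
on all measurable sets. -/
structure BA (Ω : Type*) [MeasurableSpace Ω] where
  toFun : Set Ω → ℝ
  not_measurable' : ∀ A, ¬ MeasurableSet A → toFun A = 0
  union' : ∀ A B, MeasurableSet A → MeasurableSet B → Disjoint A B →
    toFun (A ∪ B) = toFun A + toFun B
  bounded' : ∃ C, ∀ A, |toFun A| ≤ C

namespace BA

section Lattice

variable {Ω : Type*} [MeasurableSpace Ω]

instance : CoeFun (BA Ω) (fun _ => Set Ω → ℝ) := ⟨BA.toFun⟩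

theorem ext_of_measurable {μ ν : BA Ω} (h : ∀ A, MeasurableSet A → μ A = ν A) : μ = ν := by
  have h' : μ.toFun = ν.toFun := by
    funext A
    by_cases hA : MeasurableSet A
    · exact h A hA
    · rw [μ.not_measurable' A hA, ν.not_measurable' A hA]
  cases μ; cases ν; cases h'; rfl

theorem apply_empty (μ : BA Ω) : μ ∅ = 0 := by
  have h := μ.union' ∅ ∅ .empty .empty (by simp)
  simp only [Set.union_empty] at h
  linarith

instance : Zero (BA Ω) :=
  ⟨{ toFun := fun _ => 0
     not_measurable' := fun _ _ => rfl
     union' := fun _ _ _ _ _ => by simp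
     bounded' := ⟨0, fun _ => by simp⟩ }⟩

instance : Add (BA Ω) :=
  ⟨fun μ ν =>
   { toFun := fun A => μ A + ν A
     not_measurable' := fun A hA => by simp [μ.not_measurable' A hA, ν.not_measurable' A hA]
     union' := fun A B hA hB h => by rw [μ.union' A B hA hB h, ν.union' A B hA hB h]; ring
     bounded' := by
       obtain ⟨C, hC⟩ := μ.bounded'
       obtain ⟨D, hD⟩ := ν.bounded'
       exact ⟨C + D, fun A => (abs_add_le _ _).trans (add_le_add (hC A) (hD A))⟩ }⟩

instance : Neg (BA Ω) :=
  ⟨fun μ =>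
   { toFun := fun A => -μ A
     not_measurable' := fun A hA => by simp [μ.not_measurable' A hA]
     union' := fun A B hA hB h => by rw [μ.union' A B hA hB h]; ring
     bounded' := by
       obtain ⟨C, hC⟩ := μ.bounded'
       exact ⟨C, fun A => by rw [abs_neg]; exact hC A⟩ }⟩

@[simp] theorem zero_apply (A : Set Ω) : (0 : BA Ω) A = 0 := rfl
@[simp] theorem add_apply (μ ν : BA Ω) (A : Set Ω) : (μ + ν) A = μ A + ν A := rfl
@[simp] theorem neg_apply (μ : BA Ω) (A : Set Ω) : (-μ) A = -μ A := rfl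

instance : AddCommGroup (BA Ω) where
  add_assoc _ _ _ := ext_of_measurable fun _ _ => by simp [add_assoc]
  zero_add _ := ext_of_measurable fun _ _ => by simp
  add_zero _ := ext_of_measurable fun _ _ => by simp
  add_comm _ _ := ext_of_measurable fun _ _ => by simp [add_comm]
  neg_add_cancel _ := ext_of_measurable fun _ _ => by simp
  nsmul := nsmulRec
  zsmul := zsmulRec

/-- The setwise order on `ba`. -/
instance : PartialOrder (BA Ω) where
  le μ ν := ∀ A, MeasurableSet A → μ A ≤ ν A
  le_refl _ _ _ := le_rfl
  le_trans _ _ _ h k A hA := (h A hA).trans (k A hA)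
  le_antisymm _ _ h k := ext_of_measurable fun A hA => le_antisymm (h A hA) (k A hA)

theorem le_iff {μ ν : BA Ω} : μ ≤ ν ↔ ∀ A, MeasurableSet A → μ A ≤ ν A := Iff.rfl

theorem bddAbove_split (μ ν : BA Ω) (A : Set Ω) :
    BddAbove (Set.range fun B : {B : Set Ω // MeasurableSet B} => μ (A ∩ B) + ν (A \ B)) := by
  obtain ⟨C, hC⟩ := μ.bounded'
  obtain ⟨D, hD⟩ := ν.bounded'
  refine ⟨C + D, ?_⟩
  rintro _ ⟨B, rfl⟩
  exact add_le_add (le_of_abs_le (hC _)) (le_of_abs_le (hD _))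

open Classical in
/-- The supremum of two bounded finitely additive measures:
`(μ ∨ ν)(A) = sup {μ(A ∩ B) + ν(A \ B) | B measurable}`. -/
noncomputable def sup (μ ν : BA Ω) : BA Ω where
  toFun A := if MeasurableSet A then
    ⨆ B : {B : Set Ω // MeasurableSet B}, (μ (A ∩ B) + ν (A \ B)) else 0
  not_measurable' A hA := by simp [hA]
  union' A₁ A₂ h₁ h₂ hd := by
    simp only [h₁, h₂, h₁.union h₂, if_true]
    have key : ∀ B : Set Ω, MeasurableSet B →
        μ ((A₁ ∪ A₂) ∩ B) + ν ((A₁ ∪ A₂) \ B) =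
          (μ (A₁ ∩ B) + ν (A₁ \ B)) + (μ (A₂ ∩ B) + ν (A₂ \ B)) := by
      intro B hB
      rw [Set.union_inter_distrib_right, Set.union_sdiff_distrib,
        μ.union' _ _ (h₁.inter hB) (h₂.inter hB)
          (hd.mono Set.inter_subset_left Set.inter_subset_left),
        ν.union' _ _ (h₁.diff hB) (h₂.diff hB) (hd.mono Set.sdiff_subset Set.sdiff_subset)]
      ring
    apply le_antisymm
    · apply ciSup_le
      rintro ⟨B, hB⟩
      rw [key B hB]
      exact add_le_add (le_ciSup (bddAbove_split μ ν A₁) ⟨B, hB⟩)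
        (le_ciSup (bddAbove_split μ ν A₂) ⟨B, hB⟩)
    · rw [← le_sub_iff_add_le]
      apply ciSup_le
      rintro ⟨B₁, hB₁⟩
      rw [le_sub_comm]
      apply ciSup_le
      rintro ⟨B₂, hB₂⟩
      rw [le_sub_iff_add_le']
      have hB : MeasurableSet ((A₁ ∩ B₁) ∪ (A₂ ∩ B₂)) := (h₁.inter hB₁).union (h₂.inter hB₂)
      refine le_trans (le_of_eq ?_)
        (le_ciSup (bddAbove_split μ ν (A₁ ∪ A₂)) ⟨(A₁ ∩ B₁) ∪ (A₂ ∩ B₂), hB⟩)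
      have hd' : ∀ x, x ∈ A₁ → x ∈ A₂ → False := fun x a b => Set.disjoint_left.1 hd a b
      simp only []
      rw [key _ hB]
      congr 3 <;> ext x <;> have := hd' x <;> grind
  bounded' := by
    obtain ⟨C, hC⟩ := μ.bounded'
    obtain ⟨D, hD⟩ := ν.bounded'
    have h0 : 0 ≤ C + D :=
      add_nonneg ((abs_nonneg _).trans (hC ∅)) ((abs_nonneg _).trans (hD ∅))
    refine ⟨C + D, fun A => ?_⟩
    by_cases hA : MeasurableSet A
    · simp only [hA, if_true]
      have hb : ∀ B : Set Ω, |μ (A ∩ B) + ν (A \ B)| ≤ C + D := fun B =>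
        (abs_add_le _ _).trans (add_le_add (hC _) (hD _))
      rw [abs_le]
      constructor
      · exact (abs_le.1 (hb ∅)).1.trans (le_ciSup (bddAbove_split μ ν A) ⟨∅, .empty⟩)
      · exact ciSup_le fun B => (abs_le.1 (hb B)).2
    · simpa [hA] using h0

theorem sup_apply (μ ν : BA Ω) {A : Set Ω} (hA : MeasurableSet A) :
    BA.sup μ ν A = ⨆ B : {B : Set Ω // MeasurableSet B}, (μ (A ∩ B) + ν (A \ B)) := by
  simp [BA.sup, hA]

theorem le_sup_left' (μ ν : BA Ω) : μ ≤ BA.sup μ ν := fun A hA => by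
  rw [sup_apply μ ν hA]
  refine le_trans (le_of_eq ?_) (le_ciSup (bddAbove_split μ ν A) ⟨Set.univ, .univ⟩)
  simp [apply_empty]

theorem le_sup_right' (μ ν : BA Ω) : ν ≤ BA.sup μ ν := fun A hA => by
  rw [sup_apply μ ν hA]
  refine le_trans (le_of_eq ?_) (le_ciSup (bddAbove_split μ ν A) ⟨∅, .empty⟩)
  simp [apply_empty]

theorem sup_le' {μ ν κ : BA Ω} (h₁ : μ ≤ κ) (h₂ : ν ≤ κ) : BA.sup μ ν ≤ κ := fun A hA => by
  rw [sup_apply μ ν hA]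
  refine ciSup_le fun B => ?_
  refine (add_le_add (h₁ _ (hA.inter B.2)) (h₂ _ (hA.diff B.2))).trans (le_of_eq ?_)
  rw [← κ.union' _ _ (hA.inter B.2) (hA.diff B.2) Set.disjoint_sdiff_inter.symm,
    Set.inter_union_sdiff]

theorem neg_le_neg' {μ ν : BA Ω} (h : μ ≤ ν) : -ν ≤ -μ := fun A hA => neg_le_neg (h A hA)

/-- `ba` is a lattice for the setwise order. With the group structure, this gives the total
variation `|μ| = μ ⊔ -μ` and the infimum `μ ⊓ ν`. -/
noncomputable instance : Lattice (BA Ω) where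
  sup := BA.sup
  le_sup_left := le_sup_left'
  le_sup_right := le_sup_right'
  sup_le _ _ _ := sup_le'
  inf μ ν := -BA.sup (-μ) (-ν)
  inf_le_left μ ν := by simpa using neg_le_neg' (le_sup_left' (-μ) (-ν))
  inf_le_right μ ν := by simpa using neg_le_neg' (le_sup_right' (-μ) (-ν))
  le_inf κ μ ν h₁ h₂ := by
    simpa using neg_le_neg' (sup_le' (neg_le_neg' h₁) (neg_le_neg' h₂))

instance : IsOrderedAddMonoid (BA Ω) where
  add_le_add_left _ _ h κ A hA := by
    simpa using h A hA

end Lattice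

section Definitions

variable {Ω : Type*} [MeasurableSpace Ω]

/-- A finite signed (`σ`-additive) measure, seen as an element of `ba`. -/
noncomputable def ofSigned (ν : SignedMeasure Ω) : BA Ω where
  toFun := ν
  not_measurable' _ hA := ν.not_measurable hA
  union' _ _ hA hB h := VectorMeasure.of_union h hA hB
  bounded' := ⟨ν.totalVariation.real Set.univ, fun A =>
    (ν.norm_le_totalVariation A).trans (measureReal_mono (Set.subset_univ A))⟩

/-- `μ` is `σ`-additive, i.e. `μ ∈ ca(Ω, Σ)`. -/
def IsSigmaAdditive (μ : BA Ω) : Prop :=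
  ∀ A : ℕ → Set Ω, (∀ k, MeasurableSet (A k)) → Pairwise (Function.onFun Disjoint A) →
    HasSum (fun k => μ (A k)) (μ (⋃ k, A k))

/-- Orthogonality of lattice elements: `|μ| ∧ |ν| = 0`. -/
def Orthogonal (μ ν : BA Ω) : Prop := |μ| ⊓ |ν| = 0

/-- `μ` is pure (purely finitely additive): it belongs to the orthogonal complement of
`ca(Ω, Σ)` in the vector lattice `ba(Ω, Σ)`. -/
def IsPure (μ : BA Ω) : Prop := ∀ ν : BA Ω, ν.IsSigmaAdditive → Orthogonal μ ν

/-- `μ` is weakly absolutely continuous with respect to `ν`: `|ν|(A) = 0` implies `μ(A) = 0`. -/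
def WeaklyAC (μ ν : BA Ω) : Prop := ∀ A, MeasurableSet A → |ν| A = 0 → μ A = 0

/-- The outer measure of `μ` (meant for `μ ≥ 0`) at an arbitrary set. -/
noncomputable def outer (μ : BA Ω) (B : Set Ω) : ℝ :=
  ⨅ A : {A : Set Ω // MeasurableSet A ∧ B ⊆ A}, μ A

/-- Convergence in measure of the sequence `s` to `f`, through the outer measure of `|μ|`. -/
def ConvInMeasure (μ : BA Ω) (s : ℕ → Ω → ℝ) (f : Ω → ℝ) : Prop :=
  ∀ ε : ℝ, 0 < ε → Tendsto (fun k => outer |μ| {x | ε < |s k x - f x|}) atTop (𝓝 0)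

/-- The integral of a simple function. -/
noncomputable def simpleIntegral (μ : BA Ω) (h : SimpleFunc Ω ℝ) : ℝ :=
  ∑ y ∈ h.range, y * μ (h ⁻¹' {y})

/-- `f` is `μ`-integrable with integral `I`: some sequence of simple functions converges to `f`
in measure, is Cauchy for the `L¹`-seminorm of `|μ|`, and its integrals tend to `I`. -/
def HasIntegral (μ : BA Ω) (f : Ω → ℝ) (I : ℝ) : Prop :=
  ∃ s : ℕ → SimpleFunc Ω ℝ,
    ConvInMeasure μ (fun k => s k) f ∧
    Tendsto (fun p : ℕ × ℕ => simpleIntegral |μ| ((s p.1 - s p.2).map fun y => |y|))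
      atTop (𝓝 0) ∧
    Tendsto (fun k => simpleIntegral μ (s k)) atTop (𝓝 I)

end Definitions

end BA

/-! Write m for |λ|. The set function θ(A) = u(1_A) is bounded, finitely additive and zero on m-null
sets, and u is integration against θ on simple functions, which are uniformly dense in L^∞.

The Yosida–Hewitt decomposition (`exists_eq_ofSigned_add_isPure`) splits θ = κ + π with κ σ-additive
and π pure. For θ ≥ 0, κ is the largest measure below θ, namely the Carathéodory measure built from
θ; maximality makes the remainder pure. Since κ inherits the null sets of θ, it has a density k with
respect to m, and π = θ - κ also vanishes on null sets. As λ = h m with |h| = 1, the function g = k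
h gives ∫ f g dλ = ∫ f k dm.

For uniqueness, test on indicators, whose integral does not depend on the approximating sequence
(`HasIntegral.eq_simpleIntegral`). The difference of two pure parts is then pure and σ-additive,
hence zero, and the densities agree a.e. -/

namespace BA

variable {Ω : Type*} [MeasurableSpace Ω]

/-! ### Null sets and σ-additivity in `ba` -/

@[simp] theorem sub_apply (μ ν : BA Ω) (A : Set Ω) : (μ - ν) A = μ A - ν A := by
  rw [sub_eq_add_neg, add_apply, neg_apply, sub_eq_add_neg]

theorem sup_apply_eq_zero {μ ν : BA Ω} {A : Set Ω} (hA : MeasurableSet A)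
    (hμ : ∀ B ⊆ A, MeasurableSet B → μ B = 0) (hν : ∀ B ⊆ A, MeasurableSet B → ν B = 0) :
    (μ ⊔ ν) A = 0 := by
  change BA.sup μ ν A = 0
  have : Nonempty {B : Set Ω // MeasurableSet B} := ⟨⟨∅, .empty⟩⟩
  rw [sup_apply μ ν hA, iSup_congr (g := fun _ => (0 : ℝ)), ciSup_const]
  rintro ⟨B, hB⟩
  simp [hμ _ Set.inter_subset_left (hA.inter hB), hν _ Set.sdiff_subset (hA.diff hB)]

theorem abs_apply_le_abs (μ : BA Ω) {A : Set Ω} (hA : MeasurableSet A) : |μ A| ≤ |μ| A :=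
  abs_le'.2 ⟨le_abs_self μ A hA, neg_le_abs μ A hA⟩

theorem abs_apply_nonneg (μ : BA Ω) {A : Set Ω} (hA : MeasurableSet A) : 0 ≤ |μ| A :=
  (abs_nonneg _).trans (abs_apply_le_abs μ hA)

theorem abs_apply_eq_zero_iff {μ : BA Ω} {A : Set Ω} (hA : MeasurableSet A) :
    |μ| A = 0 ↔ ∀ B ⊆ A, MeasurableSet B → μ B = 0 := by
  refine ⟨fun h B hBA hB => ?_, fun h => sup_apply_eq_zero hA h
    fun B hBA hB => by simp [h B hBA hB]⟩
  have h1 := |μ|.union' B (A \ B) hB (hA.diff hB) disjoint_sdiff_self_right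
  rw [Set.union_sdiff_cancel hBA, h] at h1
  have h2 := abs_apply_nonneg μ (hA.diff hB)
  have h3 := abs_apply_le_abs μ hB
  exact abs_nonpos_iff.1 (by linarith)

theorem mono_of_nonneg {μ : BA Ω} (hμ : 0 ≤ μ) {A B : Set Ω} (hA : MeasurableSet A)
    (hB : MeasurableSet B) (h : A ⊆ B) : μ A ≤ μ B := by
  have h1 := μ.union' A (B \ A) hA (hB.diff hA) disjoint_sdiff_self_right
  rw [Set.union_sdiff_cancel h] at h1
  have h2 : 0 ≤ μ (B \ A) := hμ _ (hB.diff hA)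
  linarith

theorem apply_biUnion_range (μ : BA Ω) {A : ℕ → Set Ω} (hA : ∀ k, MeasurableSet (A k))
    (hd : Pairwise (Function.onFun Disjoint A)) (n : ℕ) :
    μ (⋃ k ∈ Finset.range n, A k) = ∑ k ∈ Finset.range n, μ (A k) := by
  induction n with
  | zero => simp [apply_empty]
  | succ n ih =>
    rw [Finset.sum_range_succ, ← ih, Finset.range_add_one, Finset.set_biUnion_insert,
      Set.union_comm]
    refine μ.union' _ _ (Finset.measurableSet_biUnion _ fun k _ => hA k) (hA n) ?_
    simp only [Set.disjoint_iUnion_left]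
    exact fun k hk => hd (Finset.mem_range.1 hk).ne

theorem sum_range_le_apply_iUnion {μ : BA Ω} (hμ : 0 ≤ μ) {A : ℕ → Set Ω}
    (hA : ∀ k, MeasurableSet (A k)) (hd : Pairwise (Function.onFun Disjoint A)) (n : ℕ) :
    ∑ k ∈ Finset.range n, μ (A k) ≤ μ (⋃ k, A k) := by
  rw [← apply_biUnion_range μ hA hd]
  exact mono_of_nonneg hμ (Finset.measurableSet_biUnion _ fun k _ => hA k)
    (MeasurableSet.iUnion hA) (Set.iUnion₂_subset fun k _ => Set.subset_iUnion A k)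

/-- Since ρ - μ is nonnegative, the defect of μ after n terms is at most that of ρ, which tends to
0. -/
theorem IsSigmaAdditive.of_le {μ ρ : BA Ω} (hρ : ρ.IsSigmaAdditive) (h0 : 0 ≤ μ) (h : μ ≤ ρ) :
    μ.IsSigmaAdditive := fun A hA hd => by
  rw [hasSum_iff_tendsto_nat_of_nonneg fun k => h0 _ (hA k)]
  have h1 : Tendsto (fun n => μ (⋃ k, A k) - (ρ (⋃ k, A k) - ∑ k ∈ Finset.range n, ρ (A k)))
      atTop (𝓝 (μ (⋃ k, A k))) := by
    simpa using ((hρ A hA hd).tendsto_sum_nat.const_sub (ρ (⋃ k, A k))).const_sub (μ (⋃ k, A k))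
  refine tendsto_of_tendsto_of_tendsto_of_le_of_le h1 tendsto_const_nhds (fun n => ?_)
    fun n => sum_range_le_apply_iUnion h0 hA hd n
  have h2 := sum_range_le_apply_iUnion (sub_nonneg.2 h) hA hd n
  simp only [sub_apply, Finset.sum_sub_distrib] at h2
  simp only
  linarith

theorem ofSigned_isSigmaAdditive (ν : SignedMeasure Ω) : (ofSigned ν).IsSigmaAdditive :=
  fun _ hA hd => ν.m_iUnion hA hd

@[simp] theorem ofSigned_apply (ν : SignedMeasure Ω) (A : Set Ω) : ofSigned ν A = ν A := rfl

theorem IsSigmaAdditive.exists_ofSigned_eq {μ : BA Ω} (hμ : μ.IsSigmaAdditive) :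
    ∃ ν : SignedMeasure Ω, ofSigned ν = μ :=
  ⟨{ measureOf' := μ
     empty' := μ.apply_empty
     not_measurable' := fun A hA => μ.not_measurable' A hA
     m_iUnion' := fun A hA hd => hμ A hA hd }, rfl⟩

/-- A finite positive measure, seen as an element of `ba`. -/
noncomputable def ofMeasure (t : Measure Ω) [IsFiniteMeasure t] : BA Ω :=
  ofSigned t.toSignedMeasure

theorem ofMeasure_apply (t : Measure Ω) [IsFiniteMeasure t] {A : Set Ω} (hA : MeasurableSet A) :
    ofMeasure t A = t.real A :=
  Measure.toSignedMeasure_apply_measurable hA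

theorem ofMeasure_nonneg (t : Measure Ω) [IsFiniteMeasure t] : 0 ≤ ofMeasure t := fun A hA => by
  rw [ofMeasure_apply t hA]; exact measureReal_nonneg

theorem IsSigmaAdditive.exists_ofMeasure_eq {μ : BA Ω} (hμ : μ.IsSigmaAdditive) (h0 : 0 ≤ μ) :
    ∃ (t : Measure Ω) (_ : IsFiniteMeasure t), ofMeasure t = μ := by
  obtain ⟨ν, rfl⟩ := hμ.exists_ofSigned_eq
  have h : 0 ≤[Set.univ] ν := by
    rw [VectorMeasure.le_restrict_univ_iff_le]
    exact fun A hA => h0 A hA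
  refine ⟨ν.toMeasureOfZeroLE Set.univ .univ h, inferInstance, ext_of_measurable fun A hA => ?_⟩
  rw [ofMeasure_apply _ hA, SignedMeasure.toMeasureOfZeroLE_real_apply _ _ _ hA]
  simp

theorem IsSigmaAdditive.exists_abs_le_ofMeasure {μ : BA Ω} (hμ : μ.IsSigmaAdditive) :
    ∃ (t : Measure Ω) (_ : IsFiniteMeasure t), |μ| ≤ ofMeasure t := by
  obtain ⟨ν, rfl⟩ := hμ.exists_ofSigned_eq
  have h (A : Set Ω) (hA : MeasurableSet A) :
      |ν A| ≤ ofMeasure ν.totalVariation A := by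
    rw [ofMeasure_apply _ hA]
    exact ν.norm_le_totalVariation A
  exact ⟨ν.totalVariation, inferInstance, abs_le'.2
    ⟨fun A hA => (abs_le'.1 (h A hA)).1, fun A hA => (abs_le'.1 (h A hA)).2⟩⟩

/-! ### Pure elements and the Yosida–Hewitt decomposition -/

theorem isPure_of_forall_measure {μ : BA Ω}
    (h : ∀ (t : Measure Ω) [IsFiniteMeasure t], |μ| ⊓ ofMeasure t ≤ 0) : μ.IsPure := fun ρ hρ => by
  -- As |ρ| lies below a measure, positive measures suffice as test elements.
  obtain ⟨t, _, ht⟩ := hρ.exists_abs_le_ofMeasure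
  exact le_antisymm ((inf_le_inf_left _ ht).trans (h t)) (le_inf (abs_nonneg _) (abs_nonneg _))

theorem IsPure.inf_ofMeasure {μ : BA Ω} (h : μ.IsPure) (t : Measure Ω) [IsFiniteMeasure t] :
    |μ| ⊓ ofMeasure t = 0 := by
  simpa only [Orthogonal, abs_of_nonneg (ofMeasure_nonneg t)] using
    h (ofMeasure t) (ofSigned_isSigmaAdditive _)

/-- Distributing addition over ⊓, the right side is the infimum of a + b, c + b, a + c and c + c,
each of which dominates the left side. -/
theorem add_inf_le_of_nonneg {a b c : BA Ω} (ha : 0 ≤ a) (hb : 0 ≤ b) (hc : 0 ≤ c) :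
    (a + b) ⊓ c ≤ a ⊓ c + b ⊓ c := by
  rw [add_inf, inf_add, inf_add]
  refine le_inf (le_inf inf_le_left ?_) (le_inf ?_ ?_) <;> refine inf_le_right.trans ?_
  · exact le_add_of_nonneg_right hb
  · exact le_add_of_nonneg_left ha
  · exact le_add_of_nonneg_left hc

theorem IsPure.sub {μ ν : BA Ω} (hμ : μ.IsPure) (hν : ν.IsPure) : (μ - ν).IsPure := by
  refine isPure_of_forall_measure fun t _ => ?_
  calc |μ - ν| ⊓ ofMeasure t ≤ (|μ| + |ν|) ⊓ ofMeasure t := by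
        refine inf_le_inf_right _ (abs_le'.2 ⟨?_, ?_⟩)
        · rw [sub_eq_add_neg]
          exact add_le_add (le_abs_self _) (neg_le_abs _)
        · rw [neg_sub, sub_eq_add_neg, add_comm]
          exact add_le_add (neg_le_abs _) (le_abs_self _)
    _ ≤ |μ| ⊓ ofMeasure t + |ν| ⊓ ofMeasure t :=
        add_inf_le_of_nonneg (abs_nonneg _) (abs_nonneg _) (ofMeasure_nonneg t)
    _ = 0 := by rw [hμ.inf_ofMeasure, hν.inf_ofMeasure, add_zero]

/-- Such an element is orthogonal to itself. This is the source of uniqueness. -/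
theorem IsPure.eq_zero_of_isSigmaAdditive {μ : BA Ω} (hμ : μ.IsPure) (h : μ.IsSigmaAdditive) :
    μ = 0 := by
  have h1 : |μ| = 0 := by simpa [Orthogonal] using hμ μ h
  refine ext_of_measurable fun A hA => ?_
  have h2 := abs_apply_le_abs μ hA
  rw [h1] at h2
  simpa using h2

/-- Every nonnegative bounded finitely additive set function dominates a largest measure. -/
theorem exists_greatest_measure_le {θ : BA Ω} (hθ : 0 ≤ θ) :
    ∃ (κ : Measure Ω) (_ : IsFiniteMeasure κ), ofMeasure κ ≤ θ ∧
      ∀ (t : Measure Ω) [IsFiniteMeasure t], ofMeasure t ≤ θ → ofMeasure t ≤ ofMeasure κ := by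
  -- The outer measure induced by `m` is the infimum of ∑ θ(A_k) over countable measurable covers.
  let m : ∀ A : Set Ω, MeasurableSet A → ℝ≥0∞ := fun A _ => ENNReal.ofReal (θ A)
  have m0 : m ∅ .empty = 0 := by simp [m, apply_empty]
  -- Finite additivity of θ gives the Carathéodory condition on measurable test sets; on the others
  -- the extension of `m` is ∞.
  have hcar : ‹MeasurableSpace Ω› ≤ (inducedOuterMeasure m .empty m0).caratheodory := by
    intro s hs
    refine OuterMeasure.ofFunction_caratheodory fun t => ?_
    by_cases ht : MeasurableSet t
    · rw [extend_eq _ ht, extend_eq _ (ht.inter hs), extend_eq _ (ht.diff hs)]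
      simp only [m]
      rw [← ENNReal.ofReal_add (hθ _ (ht.inter hs)) (hθ _ (ht.diff hs)),
        ← θ.union' _ _ (ht.inter hs) (ht.diff hs) Set.disjoint_sdiff_inter.symm,
        Set.inter_union_sdiff]
    · rw [extend_eq_top _ ht]; exact le_top
  let κ := (inducedOuterMeasure m .empty m0).toMeasure hcar
  have hκ {A : Set Ω} (hA : MeasurableSet A) : κ A ≤ ENNReal.ofReal (θ A) := by
    rw [toMeasure_apply _ _ hA]
    exact (OuterMeasure.ofFunction_le A).trans_eq (extend_eq _ hA)
  have : IsFiniteMeasure κ := ⟨(hκ .univ).trans_lt ENNReal.ofReal_lt_top⟩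
  refine ⟨κ, this, fun A hA => ?_, fun t _ ht A hA => ?_⟩
  · rw [ofMeasure_apply κ hA]
    exact ENNReal.toReal_le_of_le_ofReal (hθ A hA) (hκ hA)
  · rw [ofMeasure_apply κ hA, ofMeasure_apply t hA]
    refine ENNReal.toReal_mono (measure_ne_top _ _) ?_
    rw [toMeasure_apply _ _ hA]
    -- By countable subadditivity, a measure below θ on measurable sets is below the infimum over
    -- covers.
    refine (le_inducedOuterMeasure (μ := t.toOuterMeasure)).2 (fun B hB => ?_) A
    refine (ENNReal.le_ofReal_iff_toReal_le (measure_ne_top t B) (hθ B hB)).2 ?_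
    exact (ofMeasure_apply t hB).symm.trans_le (ht B hB)

/-- The infimum η of θ - κ and a measure t is σ-additive, being dominated by t. Then κ + η is a
measure below θ, so maximality of κ forces η ≤ 0. -/
theorem isPure_sub_of_greatest {θ : BA Ω} {κ : Measure Ω} [IsFiniteMeasure κ]
    (hκ : ofMeasure κ ≤ θ)
    (h : ∀ (t : Measure Ω) [IsFiniteMeasure t], ofMeasure t ≤ θ → ofMeasure t ≤ ofMeasure κ) :
    (θ - ofMeasure κ).IsPure := by
  refine isPure_of_forall_measure fun t _ => ?_
  rw [abs_of_nonneg (sub_nonneg.2 hκ)]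
  have h0 : 0 ≤ (θ - ofMeasure κ) ⊓ ofMeasure t := le_inf (sub_nonneg.2 hκ) (ofMeasure_nonneg t)
  obtain ⟨η, _, hη⟩ := ((ofSigned_isSigmaAdditive _).of_le h0 inf_le_right).exists_ofMeasure_eq h0
  have hadd : ofMeasure (κ + η) = ofMeasure κ + ofMeasure η :=
    ext_of_measurable fun A hA => by
      rw [add_apply, ofMeasure_apply _ hA, ofMeasure_apply _ hA, ofMeasure_apply _ hA,
        measureReal_add_apply]
  have h1 := h (κ + η) (by
    rw [hadd, hη, ← le_sub_iff_add_le']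
    exact inf_le_left)
  rw [hadd, hη] at h1
  exact le_of_add_le_add_left (h1.trans_eq (add_zero _).symm)

/-- The **Yosida–Hewitt decomposition** of a bounded finitely additive set function. -/
theorem exists_eq_ofSigned_add_isPure (θ : BA Ω) :
    ∃ (κ : SignedMeasure Ω) (π : BA Ω), π.IsPure ∧ θ = ofSigned κ + π ∧
      ∀ A, MeasurableSet A → (∀ B ⊆ A, MeasurableSet B → θ B = 0) → κ A = 0 := by
  obtain ⟨κ₁, _, h₁, h₁'⟩ := exists_greatest_measure_le (posPart_nonneg θ)
  obtain ⟨κ₂, _, h₂, h₂'⟩ := exists_greatest_measure_le (negPart_nonneg θ)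
  refine ⟨κ₁.toSignedMeasure - κ₂.toSignedMeasure, (θ⁺ - ofMeasure κ₁) - (θ⁻ - ofMeasure κ₂),
    (isPure_sub_of_greatest h₁ h₁').sub (isPure_sub_of_greatest h₂ h₂'), ?_, fun A hA h => ?_⟩
  · have h : ofSigned (κ₁.toSignedMeasure - κ₂.toSignedMeasure) = ofMeasure κ₁ - ofMeasure κ₂ :=
      ext_of_measurable fun A _ => by
        rw [sub_apply]; rfl
    rw [h]
    nth_rw 1 [← posPart_sub_negPart θ]
    abel
  -- Both θ⁺ and θ⁻ vanish at A, and each κᵢ(A) lies between 0 and one of these values.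
  · have hz : ∀ B ⊆ A, MeasurableSet B → (0 : BA Ω) B = 0 := fun _ _ _ => rfl
    have hp : θ⁺ A = 0 := sup_apply_eq_zero hA h hz
    have hn : θ⁻ A = 0 := sup_apply_eq_zero hA (fun B hB hB' => by simp [h B hB hB']) hz
    have e₁ := h₁ A hA
    have e₂ := h₂ A hA
    have e₁' := ofMeasure_nonneg κ₁ A hA
    have e₂' := ofMeasure_nonneg κ₂ A hA
    have : ofMeasure κ₁ A - ofMeasure κ₂ A = 0 := by
      simp only [zero_apply] at e₁' e₂'
      linarith
    exact this

end BA


/-! ### Integrals of simple functions and independence of the approximating sequence -/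

namespace BA

variable {Ω : Type*} [MeasurableSpace Ω]

/-- Multiplication by the values of `μ`, as a set function with values in the continuous linear
endomorphisms of `ℝ`. -/
noncomputable def toCLM (μ : BA Ω) (A : Set Ω) : ℝ →L[ℝ] ℝ := μ A • ContinuousLinearMap.id ℝ ℝ

theorem toCLM_apply (μ : BA Ω) (A : Set Ω) (y : ℝ) : μ.toCLM A y = y * μ A := by
  simp [toCLM, mul_comm]

/-- Over the zero measure all finiteness and integrability side conditions are void, so the
`setToSimpleFunc` calculus applies to any finitely additive μ. -/
theorem finMeasAdditive_toCLM (μ : BA Ω) : FinMeasAdditive (0 : Measure Ω) μ.toCLM :=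
  fun A B hA hB _ _ hd => by
    ext
    simp [toCLM_apply, μ.union' A B hA hB hd]

theorem simpleIntegral_eq_setToSimpleFunc (μ : BA Ω) (s : SimpleFunc Ω ℝ) :
    simpleIntegral μ s = s.setToSimpleFunc μ.toCLM := by
  simp [simpleIntegral, SimpleFunc.setToSimpleFunc, toCLM_apply]

theorem simpleIntegral_add (μ : BA Ω) (s t : SimpleFunc Ω ℝ) :
    simpleIntegral μ (s + t) = simpleIntegral μ s + simpleIntegral μ t := by
  simp only [simpleIntegral_eq_setToSimpleFunc]
  exact SimpleFunc.setToSimpleFunc_add _ μ.finMeasAdditive_toCLM integrable_zero_measure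
    integrable_zero_measure

theorem simpleIntegral_sub (μ : BA Ω) (s t : SimpleFunc Ω ℝ) :
    simpleIntegral μ (s - t) = simpleIntegral μ s - simpleIntegral μ t := by
  simp only [simpleIntegral_eq_setToSimpleFunc]
  exact SimpleFunc.setToSimpleFunc_sub _ μ.finMeasAdditive_toCLM integrable_zero_measure
    integrable_zero_measure

theorem simpleIntegral_indicator (μ : BA Ω) {A : Set Ω} (hA : MeasurableSet A) (c : ℝ) :
    simpleIntegral μ (SimpleFunc.piecewise A hA (.const Ω c) (.const Ω 0)) = c * μ A := by
  rw [simpleIntegral_eq_setToSimpleFunc, SimpleFunc.setToSimpleFunc_indicator _ _ hA, toCLM_apply]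
  ext
  simp [toCLM_apply, apply_empty]

theorem simpleIntegral_const (μ : BA Ω) (c : ℝ) :
    simpleIntegral μ (.const Ω c) = c * μ Set.univ := by
  rw [simpleIntegral_eq_setToSimpleFunc, SimpleFunc.setToSimpleFunc_const, toCLM_apply]
  ext
  simp [toCLM_apply, apply_empty]

theorem simpleIntegral_mono {μ : BA Ω} (hμ : 0 ≤ μ) {s t : SimpleFunc Ω ℝ} (h : s ≤ t) :
    simpleIntegral μ s ≤ simpleIntegral μ t := by
  simp only [simpleIntegral_eq_setToSimpleFunc]
  refine SimpleFunc.setToSimpleFunc_mono μ.finMeasAdditive_toCLM (fun A hA _ y hy => ?_)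
    integrable_zero_measure integrable_zero_measure h
  rw [toCLM_apply]
  exact mul_nonneg hy (hμ A hA)

theorem abs_simpleIntegral_le (μ : BA Ω) (s : SimpleFunc Ω ℝ) :
    |simpleIntegral μ s| ≤ simpleIntegral |μ| (s.map fun y => |y|) := by
  rw [simpleIntegral_eq_setToSimpleFunc |μ|, SimpleFunc.map_setToSimpleFunc _
    |μ|.finMeasAdditive_toCLM integrable_zero_measure abs_zero]
  refine (Finset.abs_sum_le_sum_abs _ _).trans (Finset.sum_le_sum fun y _ => ?_)
  rw [toCLM_apply, abs_mul]
  exact mul_le_mul_of_nonneg_left (abs_apply_le_abs μ (s.measurableSet_fiber y)) (abs_nonneg y)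

theorem outer_eq_of_measurableSet {μ : BA Ω} (hμ : 0 ≤ μ) {A : Set Ω} (hA : MeasurableSet A) :
    outer μ A = μ A := by
  have : Nonempty {B : Set Ω // MeasurableSet B ∧ A ⊆ B} := ⟨⟨A, hA, subset_rfl⟩⟩
  refine le_antisymm ?_ (le_ciInf fun B => mono_of_nonneg hμ hA B.2.1 B.2.2)
  refine ciInf_le (f := fun B : {B : Set Ω // MeasurableSet B ∧ A ⊆ B} => μ B)
    ⟨0, ?_⟩ ⟨A, hA, subset_rfl⟩
  rintro _ ⟨B, rfl⟩
  exact hμ _ B.2.1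

theorem outer_eq_zero_of_subset {μ : BA Ω} (hμ : 0 ≤ μ) {A B : Set Ω} (hA : MeasurableSet A)
    (hBA : B ⊆ A) (h : μ A = 0) : outer μ B = 0 := by
  have : Nonempty {C : Set Ω // MeasurableSet C ∧ B ⊆ C} := ⟨⟨A, hA, hBA⟩⟩
  refine le_antisymm (h ▸ ?_) (le_ciInf fun C => hμ _ C.2.1)
  refine ciInf_le (f := fun C : {C : Set Ω // MeasurableSet C ∧ B ⊆ C} => μ C)
    ⟨0, ?_⟩ ⟨A, hA, hBA⟩
  rintro _ ⟨C, rfl⟩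
  exact hμ _ C.2.1

theorem exists_abs_le (s : SimpleFunc Ω ℝ) : ∃ M, 0 ≤ M ∧ ∀ x, |s x| ≤ M := by
  obtain ⟨M, hM⟩ := s.exists_forall_norm_le
  exact ⟨max M 0, le_max_right _ _, fun x => (hM x).trans (le_max_left _ _)⟩

/-- The integral of a simple function does not depend on the approximating sequence. -/
theorem HasIntegral.eq_simpleIntegral {μ : BA Ω} {f : SimpleFunc Ω ℝ} {I : ℝ}
    (h : μ.HasIntegral f I) : I = simpleIntegral μ f := by
  obtain ⟨s, hconv, hcauchy, hlim⟩ := h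
  refine tendsto_nhds_unique hlim ?_
  have hμ : 0 ≤ |μ| := abs_nonneg μ
  rw [Metric.tendsto_atTop]
  intro ε hε
  -- Freeze the index `p.2`: `s p.2 - f` is simple, hence bounded by some M. This controls `s k - f`
  -- on the exceptional set, where convergence in measure gives no pointwise bound.
  obtain ⟨p, hp⟩ := eventually_atTop.1 ((tendsto_order.1 hcauchy).2 (ε / 3) (by positivity))
  obtain ⟨M, hM0, hM⟩ := exists_abs_le (s p.2 - f)
  set V := |μ| Set.univ
  have hV : 0 ≤ V := hμ _ .univ
  set δ := ε / (3 * (V + 1))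
  have hδ : 0 < δ := by positivity
  have hδV : δ * V < ε / 3 := by
    have : δ * (V + 1) = ε / 3 := by simp only [δ]; field_simp
    linarith
  obtain ⟨K, hK⟩ := eventually_atTop.1
    ((tendsto_order.1 (hconv δ hδ)).2 (ε / (3 * (M + 1))) (by positivity))
  refine ⟨max K p.1, fun k hk => ?_⟩
  have hkK := hK k ((le_max_left _ _).trans hk)
  have hkp := hp (k, p.2) ⟨(le_max_right _ _).trans hk, le_rfl⟩
  have hE : MeasurableSet {x | δ < |s k x - f x|} :=
    measurableSet_lt measurable_const ((s k).measurable.sub f.measurable).abs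
  rw [outer_eq_of_measurableSet hμ hE] at hkK
  have hME : M * |μ| {x | δ < |s k x - f x|} ≤ ε / 3 := by
    have h1 : (M + 1) * (ε / (3 * (M + 1))) = ε / 3 := by field_simp
    have h2 := abs_apply_nonneg μ hE
    nlinarith
  rw [Real.dist_eq, ← simpleIntegral_sub]
  refine (abs_simpleIntegral_le _ _).trans_lt ?_
  -- The three terms are the Cauchy error, M on the exceptional set and δ everywhere; each
  -- integrates to at most ε / 3, the first strictly less.
  have hle : (s k - f).map (fun y => |y|) ≤ (s k - s p.2).map (fun y => |y|) +
      (SimpleFunc.piecewise _ hE (.const Ω M) (.const Ω 0) + .const Ω δ) := fun x => by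
    simp only [SimpleFunc.coe_map, Function.comp_apply, SimpleFunc.coe_sub, Pi.sub_apply,
      SimpleFunc.coe_add, Pi.add_apply, SimpleFunc.coe_piecewise, SimpleFunc.coe_const,
      Function.const_apply]
    by_cases hx : x ∈ {x | δ < |s k x - f x|}
    · rw [Set.piecewise_eq_of_mem _ _ _ hx]
      have h1 := abs_sub_le (s k x) (s p.2 x) (f x)
      have h2 := hM x
      simp only [SimpleFunc.coe_sub, Pi.sub_apply] at h2
      simp only [Function.const_apply]
      linarith
    · rw [Set.piecewise_eq_of_notMem _ _ _ hx]
      have h1 := abs_nonneg (s k x - s p.2 x)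
      have h2 : |s k x - f x| ≤ δ := not_lt.1 hx
      simp only [Function.const_apply]
      linarith
  have h3 := simpleIntegral_mono hμ hle
  rw [simpleIntegral_add, simpleIntegral_add, simpleIntegral_indicator, simpleIntegral_const] at h3
  change simpleIntegral |μ| ((s k - s p.2).map fun y => |y|) < ε / 3 at hkp
  linarith

/-- A function which is the uniform limit of simple functions off a null set is integrable. -/
theorem hasIntegral_of_uniform {μ : BA Ω} {f : Ω → ℝ} {I : ℝ} {s : ℕ → SimpleFunc Ω ℝ}
    {N : Set Ω} (hN : MeasurableSet N) (hμN : |μ| N = 0) {f' : Ω → ℝ} (hf : ∀ x ∉ N, f x = f' x)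
    {e : ℕ → ℝ} (he : Tendsto e atTop (𝓝 0)) (hs : ∀ k x, |s k x - f' x| ≤ e k)
    (hI : Tendsto (fun k => simpleIntegral μ (s k)) atTop (𝓝 I)) : μ.HasIntegral f I := by
  have hμ : 0 ≤ |μ| := abs_nonneg μ
  refine ⟨s, fun ε hε => ?_, ?_, hI⟩
  · refine tendsto_const_nhds.congr' ?_
    -- Once e k < ε, the exceptional set lies inside N, so its outer measure is exactly 0.
    filter_upwards [(tendsto_order.1 he).2 ε hε] with k hk
    refine (outer_eq_zero_of_subset hμ hN (fun x hx => ?_) hμN).symm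
    by_contra hxN
    rw [Set.mem_ofPred_eq, hf x hxN] at hx
    linarith [hs k x]
  · have h1 : Tendsto (fun p : ℕ × ℕ => (e p.1 + e p.2) * |μ| Set.univ) atTop (𝓝 0) := by
      rw [← prod_atTop_atTop_eq]
      simpa using ((he.comp tendsto_fst).add (he.comp tendsto_snd)).mul_const (|μ| Set.univ)
    refine tendsto_of_tendsto_of_tendsto_of_le_of_le tendsto_const_nhds h1 (fun p => ?_)
      fun p => ?_
    · exact (abs_nonneg _).trans (abs_simpleIntegral_le μ _)
    · dsimp only
      rw [← simpleIntegral_const]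
      refine simpleIntegral_mono hμ fun x => ?_
      have h2 := abs_sub_le (s p.1 x) (f' x) (s p.2 x)
      rw [abs_sub_comm (f' x)] at h2
      exact h2.trans (add_le_add (hs _ _) (hs _ _))

end BA

/-! ### The sign of a signed measure -/

namespace MeasureTheory

variable {Ω : Type*} [MeasurableSpace Ω]

theorem SignedMeasure.isFiniteMeasure_variation (ν : SignedMeasure Ω) :
    IsFiniteMeasure ν.variation := by
  rw [← ν.totalVariation_eq_variation]; infer_instance

/-- A signed measure has a density `±1` with respect to its variation. -/
theorem SignedMeasure.exists_sign (ν : SignedMeasure Ω) :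
    ∃ h : Ω → ℝ, Measurable h ∧ (∀ x, |h x| = 1) ∧
      ∀ φ : Ω → ℝ, Integrable φ ν.variation →
        ∫ᵛ x, φ x ∂<•ν = ∫ x, φ x * h x ∂ν.variation := by
  classical
  set j := ν.toJordanDecomposition
  obtain ⟨S, hS, hpS, hnS⟩ := j.mutuallySingular
  -- The positive part vanishes on S and the negative part off S, so the sign is -1 on S and 1
  -- elsewhere.
  refine ⟨S.piecewise (fun _ => (-1 : ℝ)) (fun _ => 1), measurable_const.piecewise hS measurable_const,
    fun x => by by_cases hx : x ∈ S <;> simp [hx], fun φ hφ => ?_⟩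
  have hν : ν = j.posPart.toSignedMeasure - j.negPart.toSignedMeasure :=
    ν.toSignedMeasure_toJordanDecomposition.symm
  have hvar : ν.variation = j.posPart + j.negPart := ν.totalVariation_eq_variation.symm
  rw [hvar] at hφ ⊢
  have hp : Integrable φ j.posPart := hφ.left_of_add_measure
  have hn : Integrable φ j.negPart := hφ.right_of_add_measure
  have ep : (fun x => φ x * S.piecewise (fun _ => (-1 : ℝ)) (fun _ => 1) x) =ᵐ[j.posPart] φ := by
    filter_upwards [measure_eq_zero_iff_ae_notMem.1 hpS] with x hx
    simp [hx]
  have en : (fun x => φ x * S.piecewise (fun _ => (-1 : ℝ)) (fun _ => 1) x) =ᵐ[j.negPart] -φ := by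
    filter_upwards [measure_eq_zero_iff_ae_notMem.1 hnS] with x hx
    rw [Set.mem_compl_iff, not_not] at hx
    simp [hx]
  rw [integral_add_measure (hp.congr ep.symm) (hn.neg.congr en.symm), integral_congr_ae ep,
    integral_congr_ae en, integral_neg', ← sub_eq_add_neg]
  conv_lhs => rw [hν]
  rw [VectorMeasure.integral_sub_vectorMeasure, VectorMeasure.integral_toSignedMeasure,
    VectorMeasure.integral_toSignedMeasure]
  · simpa [VectorMeasure.Integrable] using hp
  · simpa [VectorMeasure.Integrable] using hn

end MeasureTheory


/-! ### Uniform approximation of essentially bounded functions -/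

namespace MeasureTheory

variable {Ω : Type*} [MeasurableSpace Ω]

/-- A bounded measurable real function is a uniform limit of simple functions. -/
theorem exists_simpleFunc_abs_sub_le {f : Ω → ℝ} (hf : Measurable f) {C : ℝ} (hC : ∀ x, |f x| ≤ C)
    {ε : ℝ} (hε : 0 < ε) : ∃ s : SimpleFunc Ω ℝ, ∀ x, |s x - f x| ≤ ε := by
  -- Round f down to a multiple of ε; boundedness of f makes the range finite.
  refine ⟨⟨fun x => ε * ⌊f x / ε⌋, fun y => ?_, ?_⟩, fun x => ?_⟩
  · have : Measurable fun x => ε * (⌊f x / ε⌋ : ℝ) := by fun_prop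
    exact this (measurableSet_singleton y)
  · refine ((Set.finite_Icc ⌊-C / ε⌋ ⌊C / ε⌋).image fun n : ℤ => ε * (n : ℝ)).subset ?_
    rintro _ ⟨x, rfl⟩
    have h := abs_le.1 (hC x)
    exact ⟨⌊f x / ε⌋, ⟨Int.floor_mono (by gcongr; exact h.1), Int.floor_mono (by gcongr; exact h.2)⟩,
      rfl⟩
  · have h1 := Int.floor_le (f x / ε)
    have h2 := Int.lt_floor_add_one (f x / ε)
    have h3 : ε * (f x / ε) = f x := by field_simp
    rw [SimpleFunc.coe_mk, abs_le]
    constructor <;> nlinarith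

/-- An essentially bounded real function agrees almost everywhere with a bounded measurable one. -/
theorem MemLp.exists_bounded_measurable {m : Measure Ω} {f : Ω → ℝ} (hf : MemLp f ∞ m) :
    ∃ (f' : Ω → ℝ) (C : ℝ), Measurable f' ∧ (∀ x, |f' x| ≤ C) ∧ f =ᵐ[m] f' := by
  set C := (eLpNormEssSup f m).toReal
  have hC : 0 ≤ C := ENNReal.toReal_nonneg
  -- Truncate a measurable version of f at its essential supremum.
  refine ⟨fun x => max (-C) (min C (hf.1.mk f x)), C, ?_, fun x => ?_, ?_⟩
  · have := hf.1.stronglyMeasurable_mk.measurable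
    fun_prop
  · exact abs_le.2 ⟨le_max_left _ _, max_le (by linarith) (min_le_left _ _)⟩
  · have hfin : eLpNormEssSup f m ≠ ∞ := by
      rw [← eLpNorm_exponent_top]; exact hf.2.ne
    filter_upwards [hf.1.ae_eq_mk, ae_le_eLpNormEssSup (f := f) (μ := m)] with x hx hb
    have h1 : |f x| ≤ C := by
      have := ENNReal.toReal_mono hfin hb
      rwa [toReal_enorm] at this
    rw [← hx, min_eq_right (abs_le.1 h1).2, max_eq_right (abs_le.1 h1).1]

theorem MemLp.integrable_fun_mul {m : Measure Ω} {f k : Ω → ℝ} (hf : MemLp f ∞ m)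
    (hk : Integrable k m) : Integrable (fun x => f x * k x) m :=
  hk.mul_of_top_right hf

end MeasureTheory

/-! ### Functionals on `L^∞` as set functions -/

namespace BA

variable {Ω : Type*} [MeasurableSpace Ω]

/-- Both sides say that ν vanishes on every measurable subset of A, so the lattice modulus and the
variation need not be identified. -/
theorem abs_ofSigned_eq_zero_iff {ν : SignedMeasure Ω} {A : Set Ω} (hA : MeasurableSet A) :
    |ofSigned ν| A = 0 ↔ ν.variation A = 0 := by
  rw [abs_apply_eq_zero_iff hA, VectorMeasure.variation_apply_eq_zero hA]
  rfl

theorem simpleIntegral_add_left (μ ρ : BA Ω) (s : SimpleFunc Ω ℝ) :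
    simpleIntegral (μ + ρ) s = simpleIntegral μ s + simpleIntegral ρ s := by
  simp [simpleIntegral, mul_add, Finset.sum_add_distrib]

section Dual

variable {m : Measure Ω} [IsFiniteMeasure m]

open Classical in
/-- The set function `A ↦ u(1_A)` of a continuous linear functional `u` on `L^∞`. -/
noncomputable def ofDual (u : StrongDual ℝ (Lp ℝ ∞ m)) : BA Ω where
  toFun A := if hA : MeasurableSet A then u (indicatorConstLp ∞ hA (measure_ne_top m A) 1) else 0
  not_measurable' A hA := by simp [hA]
  union' A B hA hB hd := by
    simp only [hA, hB, hA.union hB, dite_true]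
    rw [indicatorConstLp_disjoint_union hA hB (measure_ne_top m A) (measure_ne_top m B) hd, map_add]
  bounded' := by
    refine ⟨‖u‖, fun A => ?_⟩
    by_cases hA : MeasurableSet A
    · simp only [hA, dite_true]
      have h := norm_indicatorConstLp_le (p := ∞) (hs := hA) (hμs := measure_ne_top m A) (c := (1 : ℝ))
      refine (u.le_opNorm _).trans (mul_le_of_le_one_right (norm_nonneg u) ?_)
      simpa using h
    · simp [hA]

theorem ofDual_apply (u : StrongDual ℝ (Lp ℝ ∞ m)) {A : Set Ω} (hA : MeasurableSet A) :
    ofDual u A = u (indicatorConstLp ∞ hA (measure_ne_top m A) 1) := by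
  simp [ofDual, hA]

theorem ofDual_apply_eq_zero (u : StrongDual ℝ (Lp ℝ ∞ m)) {A : Set Ω} (hA : MeasurableSet A)
    (h : m A = 0) : ofDual u A = 0 := by
  rw [ofDual_apply u hA]
  convert map_zero u
  rw [Lp.eq_zero_iff_ae_eq_zero]
  refine indicatorConstLp_coeFn.trans (indicator_meas_zero h)

theorem simpleIntegral_ofDual (u : StrongDual ℝ (Lp ℝ ∞ m)) (s : SimpleFunc Ω ℝ) :
    simpleIntegral (ofDual u) s = u ((s.memLp_top m).toLp s) := by
  induction s using SimpleFunc.induction with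
  | @const c A hs =>
    rw [simpleIntegral_indicator, ofDual_apply u hs, ← smul_eq_mul, ← map_smul]
    congr 1
    ext1
    grw [Lp.coeFn_smul, MemLp.coeFn_toLp]
    filter_upwards [indicatorConstLp_coeFn (p := ∞) (hs := hs) (hμs := measure_ne_top m A)
      (c := (1 : ℝ))] with x hx
    simp only [Pi.smul_apply, hx, smul_eq_mul, SimpleFunc.coe_piecewise, SimpleFunc.coe_const]
    by_cases h : x ∈ A <;> simp [h]
  | @add f g _ hf hg =>
    rw [simpleIntegral_add, hf, hg, ← map_add, ← MemLp.toLp_add]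
    rfl

theorem simpleIntegral_eq_integral_mul {m : Measure Ω} {μ : BA Ω} {k : Ω → ℝ} (hk : Integrable k m)
    (h : ∀ A, MeasurableSet A → μ A = ∫ x in A, k x ∂m) (s : SimpleFunc Ω ℝ) :
    simpleIntegral μ s = ∫ x, s x * k x ∂m := by
  induction s using SimpleFunc.induction with
  | @const c A hs =>
    rw [simpleIntegral_indicator, h _ hs, ← integral_const_mul, ← integral_indicator hs]
    congr 1 with x
    by_cases hx : x ∈ A <;> simp [hx]
  | @add f g _ hf hg =>
    rw [simpleIntegral_add, hf, hg, ← integral_add ((f.memLp_top m).integrable_fun_mul hk)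
      ((g.memLp_top m).integrable_fun_mul hk)]
    congr 1 with x
    simp [add_mul]

theorem tendsto_toLp_of_abs_sub_le {f : Ω → ℝ} (hf : MemLp f ∞ m) {f' : Ω → ℝ} (hff' : f =ᵐ[m] f')
    {s : ℕ → SimpleFunc Ω ℝ} {e : ℕ → ℝ} (he : Tendsto e atTop (𝓝 0)) (he0 : ∀ n, 0 ≤ e n)
    (hs : ∀ n x, |s n x - f' x| ≤ e n) :
    Tendsto (fun n => ((s n).memLp_top m).toLp (s n)) atTop (𝓝 (hf.toLp f)) := by
  rw [tendsto_iff_norm_sub_tendsto_zero]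
  refine squeeze_zero (fun _ => norm_nonneg _) (fun n => ?_) he
  rw [← MemLp.toLp_sub]
  refine (Lp.norm_le_of_ae_bound (he0 n) ?_).trans_eq (by simp)
  filter_upwards [MemLp.coeFn_toLp (((s n).memLp_top m).sub hf), hff'] with x hx hx'
  rw [hx, Pi.sub_apply, hx']
  exact hs n x

theorem tendsto_integral_mul_of_abs_sub_le {m : Measure Ω} {f : Ω → ℝ} (hf : MemLp f ∞ m) {f' : Ω → ℝ}
    (hff' : f =ᵐ[m] f') {k : Ω → ℝ} (hk : Integrable k m)
    {s : ℕ → SimpleFunc Ω ℝ} {e : ℕ → ℝ} (he : Tendsto e atTop (𝓝 0))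
    (hs : ∀ n x, |s n x - f' x| ≤ e n) :
    Tendsto (fun n => ∫ x, s n x * k x ∂m) atTop (𝓝 (∫ x, f x * k x ∂m)) := by
  rw [tendsto_iff_norm_sub_tendsto_zero]
  have h1 : Tendsto (fun n => e n * ∫ x, |k x| ∂m) atTop (𝓝 0) := by
    simpa using he.mul_const (∫ x, |k x| ∂m)
  refine squeeze_zero (fun _ => norm_nonneg _) (fun n => ?_) h1
  rw [← integral_sub (((s n).memLp_top m).integrable_fun_mul hk) (hf.integrable_fun_mul hk),
    ← integral_const_mul]
  refine norm_integral_le_of_norm_le (hk.abs.const_mul _) ?_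
  filter_upwards [hff'] with x hx
  rw [Real.norm_eq_abs, ← sub_mul, abs_mul, hx]
  exact mul_le_mul_of_nonneg_right (hs n x) (abs_nonneg _)

/-- Every continuous linear functional on `L^∞` of a finite measure is the sum of an integral
against an integrable density and of the integral of a pure, weakly absolutely continuous
bounded finitely additive set function. -/
theorem exists_density_add_isPure (u : StrongDual ℝ (Lp ℝ ∞ m)) :
    ∃ (k : Ω → ℝ) (π : BA Ω), Integrable k m ∧ π.IsPure ∧
      (∀ A, MeasurableSet A → m A = 0 → π A = 0) ∧
      ∀ (f : Ω → ℝ) (hf : MemLp f ∞ m),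
        π.HasIntegral f (u (hf.toLp f) - ∫ x, f x * k x ∂m) := by
  obtain ⟨κ, π, hπ, hθ, hκ⟩ := exists_eq_ofSigned_add_isPure (ofDual u)
  have hκ0 {A : Set Ω} (hA : MeasurableSet A) (h : m A = 0) : κ A = 0 :=
    hκ A hA fun B hBA hB => ofDual_apply_eq_zero u hB (measure_mono_null hBA h)
  have hπ0 : ∀ A, MeasurableSet A → m A = 0 → π A = 0 := fun A hA h => by
    have h1 := ofDual_apply_eq_zero u hA h
    rw [hθ, add_apply, ofSigned_apply, hκ0 hA h, zero_add] at h1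
    exact h1
  have hac : κ ≪ᵥ m.toENNRealVectorMeasure := by
    refine VectorMeasure.AbsolutelyContinuous.mk fun A hA h => hκ0 hA ?_
    rwa [Measure.toENNRealVectorMeasure_apply_measurable hA] at h
  have hk : Integrable (κ.rnDeriv m) m := κ.integrable_rnDeriv m
  have hκk : ∀ A, MeasurableSet A → ofSigned κ A = ∫ x in A, κ.rnDeriv m x ∂m := fun A hA => by
    rw [← withDensityᵥ_apply hk hA, κ.withDensityᵥ_rnDeriv_eq m hac]
    rfl
  refine ⟨κ.rnDeriv m, π, hk, hπ, hπ0, fun f hf => ?_⟩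
  obtain ⟨f', C, hf', hC, hff'⟩ := hf.exists_bounded_measurable
  obtain ⟨N, hN, hNm, hN0⟩ := exists_measurable_superset_of_null (ae_iff.1 hff')
  choose s hs using fun n : ℕ =>
    exists_simpleFunc_abs_sub_le hf' hC (Nat.one_div_pos_of_nat (α := ℝ) (n := n))
  have he : Tendsto (fun n : ℕ => 1 / ((n : ℝ) + 1)) atTop (𝓝 0) :=
    tendsto_one_div_add_atTop_nhds_zero_nat
  refine hasIntegral_of_uniform hNm ?_ (fun x hx => ?_) he hs ?_
  · exact (abs_apply_eq_zero_iff hNm).2 fun B hBN hB => hπ0 B hB (measure_mono_null hBN hN0)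
  · by_contra h
    exact hx (hN h)
  -- On simple functions π is θ - κ; both terms pass to the uniform limit, u by continuity and the
  -- other because k is integrable.
  · have h1 (n : ℕ) : simpleIntegral π (s n) =
        u (((s n).memLp_top m).toLp (s n)) - ∫ x, s n x * κ.rnDeriv m x ∂m := by
      rw [← simpleIntegral_ofDual, hθ, simpleIntegral_add_left,
        simpleIntegral_eq_integral_mul hk hκk, add_sub_cancel_left]
    simp only [h1]
    exact ((u.continuous.tendsto _).comp
      (tendsto_toLp_of_abs_sub_le hf hff' he (fun n => by positivity) hs)).sub
      (tendsto_integral_mul_of_abs_sub_le hf hff' hk he hs)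

end Dual

/-- The density and the pure part in a representation of a functional on indicator functions
are unique. -/
theorem density_and_isPure_unique {m : Measure Ω} {k₁ k₂ : Ω → ℝ} {π₁ π₂ : BA Ω} (hk₁ : Integrable k₁ m)
    (hk₂ : Integrable k₂ m) (hπ₁ : π₁.IsPure) (hπ₂ : π₂.IsPure)
    (h : ∀ A, MeasurableSet A → (∫ x in A, k₁ x ∂m) + π₁ A = (∫ x in A, k₂ x ∂m) + π₂ A) :
    k₁ =ᵐ[m] k₂ ∧ π₁ = π₂ := by
  have hπ : π₁ = π₂ := by
    refine sub_eq_zero.1 ((hπ₁.sub hπ₂).eq_zero_of_isSigmaAdditive ?_)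
    -- The hypothesis gives π₁ - π₂ the density k₂ - k₁, so the difference is σ-additive.
    have : π₁ - π₂ = ofSigned (m.withDensityᵥ (k₂ - k₁)) := ext_of_measurable fun A hA => by
      rw [sub_apply, ofSigned_apply, withDensityᵥ_apply (hk₂.sub hk₁) hA,
        integral_sub' hk₂.integrableOn hk₁.integrableOn]
      linarith [h A hA]
    rw [this]
    exact ofSigned_isSigmaAdditive _
  subst hπ
  exact ⟨hk₁.ae_eq_of_forall_setIntegral_eq k₁ k₂ hk₂ fun A hA _ => add_right_cancel (h A hA), rfl⟩

end BA

/-! ### The representation theorem: from the variation back to λ -/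

theorem mainTheorem1 {Ω : Type*} [MeasurableSpace Ω] (ν : SignedMeasure Ω)
    (u : StrongDual ℝ (Lp ℝ ∞ ν.variation)) :
    ∃! p : Lp ℝ 1 ν.variation × BA Ω,
      p.2.IsPure ∧ p.2.WeaklyAC (BA.ofSigned ν) ∧
      ∀ (f : Ω → ℝ) (hf : MemLp f ∞ ν.variation),
        ∃ I : ℝ, p.2.HasIntegral f I ∧
          u (hf.toLp f) = (∫ᵛ x, f x * p.1 x ∂<•ν) + I := by
  have := ν.isFiniteMeasure_variation
  obtain ⟨h, hm, h1, hν⟩ := ν.exists_sign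
  have hh (x : Ω) : h x * h x = 1 := by rw [← abs_mul_abs_self, h1, one_mul]
  have hL : MemLp h ∞ ν.variation :=
    memLp_top_of_bound hm.aestronglyMeasurable 1 (.of_forall fun x => (h1 x).le)
  have hmul {g : Ω → ℝ} (hg : Integrable g ν.variation) :
      Integrable (fun x => g x * h x) ν.variation := hg.mul_of_top_left hL
  obtain ⟨k, π, hk, hπ, hπ0, hrep⟩ := BA.exists_density_add_isPure u
  -- Take g = k h: integrating f g against λ = h m brings in a second factor h, and h² = 1.
  refine ⟨((hmul hk).toL1 _, π), ⟨hπ, fun A hA h0 => ?_, fun f hf => ⟨_, hrep f hf, ?_⟩⟩, ?_⟩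
  · exact hπ0 A hA ((BA.abs_ofSigned_eq_zero_iff hA).1 h0)
  · rw [hν _ (hf.integrable_fun_mul (L1.integrable_coeFn _)), eq_comm, ← eq_sub_iff_add_eq,
      sub_sub_cancel]
    refine integral_congr_ae ?_
    filter_upwards [(hmul hk).coeFn_toL1] with x hx
    rw [hx, mul_assoc, mul_assoc, hh, mul_one]
  · rintro ⟨g, ρ⟩ ⟨hρ, -, hrep'⟩
    have hg : Integrable g ν.variation := L1.integrable_coeFn g
    have key : ∀ A, MeasurableSet A →
        (∫ x in A, g x * h x ∂ν.variation) + ρ A = (∫ x in A, k x ∂ν.variation) + π A := by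
      intro A hA
      -- On an indicator, the integrals against ρ and π can only be ρ(A) and π(A), so both
      -- representations compute u(1_A).
      let s : SimpleFunc Ω ℝ := SimpleFunc.piecewise A hA (.const Ω 1) (.const Ω 0)
      have hs := s.memLp_top ν.variation
      have hmul_s (φ : Ω → ℝ) : (∫ x, s x * φ x ∂ν.variation) = ∫ x in A, φ x ∂ν.variation := by
        rw [← integral_indicator hA]
        congr 1 with x
        by_cases hx : x ∈ A <;> simp [s, hx]
      obtain ⟨I, hI, hu⟩ := hrep' s hs
      rw [hI.eq_simpleIntegral, BA.simpleIntegral_indicator, one_mul,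
        hν _ (hs.integrable_fun_mul hg)] at hu
      simp only [mul_assoc] at hu
      rw [hmul_s] at hu
      have hJ := (hrep s hs).eq_simpleIntegral
      rw [BA.simpleIntegral_indicator, one_mul, hu, hmul_s] at hJ
      linarith
    obtain ⟨hgk, rfl⟩ := BA.density_and_isPure_unique (hmul hg) hk hρ hπ key
    refine Prod.ext (Lp.ext ?_) rfl
    filter_upwards [hgk, (hmul hk).coeFn_toL1] with x hx hx'
    rw [hx', ← hx, mul_assoc, hh, mul_one]
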